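/- Let $p\ge 1$, $n\ge 0$, $\alpha\in(0,1]$ and $\lambda_1,\dots,\lambda_p>0$. Let $Q=(q_{ij})$ be the transition matrix of a Markov chain on $E=\{1,\dots,p+1\}$ whose states $1,\dots,p$ are transient with $q_{ii}=0$, and whose state $p+1$ is absorbing. Let $(C_m)_{m\ge 0}$ be a Markov chain on $E$ with transition matrix $Q$ and initial distribution $\pi=(\pi_1,\dots,\pi_p)$ concentrated on $\{1,\dots,p\}$, i.e. $\pi_i\ge 0$, $\sum_{i=1}^p\pi_i=1$. For $i=1,\dots,p$ and $m\ge 1$ let $T^i_m$ be random variables that are mutually independent, independent of the chain $(C_m)$, and such that $T^i_m$ has the Mittag-Leffler distribution $\mathrm{ML}(\alpha,\lambda_i)$, i.e. has density $$f(x)=\lambda_i x^{\alpha-1}E_{\alpha,\alpha}(-\lambda_i x^\alpha)\quad (x>0),\qquad E_{\alpha,\beta}(z)=\sum_{k=0}^\infty \frac{z^k}{\Gamma(\alpha k+\beta)}.$$ Put $T^{p+1}_m=\infty$, $S_m=\sum_{l=1}^m T^{C_{l-1}}_l$ ($S_0=0$), let $X_t=C_{m-1}$ for $S_{m-1}\le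 t<S_m$, $m\ge 1$, be the associated semi-Markov process, and let $\tau=\inf\{t\ge 0: X_t=p+1\}$ be its absorption time. Let $R=(r_{ik})$ be a $p\times n$ matrix with non-negative entries and put $$Y_k=\int_0^\tau\sum_{i=1}^p r_{ik}1\{X_t=i\}\,dt,\qquad k=1,\dots,n.$$ Let $T$ be the $p\times p$ matrix with $T_{ii}=-\lambda_i$ and $T_{ij}=\lambda_i q_{ij}$ for $i\ne j$, and let $t$ be the column vector with entries $t_i=\lambda_i q_{i,p+1}$. Then $\tau<\infty$ almost surely, $Y=(Y_1,\dots,Y_n)$ is an (almost everywhere defined) random vector, and for every $\theta=(\theta_1,\dots,\theta_n)\in[0,\infty)^n$ the matrix $\Delta(R\theta)^\alpha-T$ is invertible and $$\mathbb E\big(e^{-\langle Y,\theta\rangle}\big)=\pi\,\big(\Delta(R\theta)^\alpha-T\big)^{-1}t,$$ where $\Delta(R\theta)^\alpha$ is the diagonal matrix with diagonal entries $\big(\sum_{k=1}^n r_{ik}\theta_k\big)^\alpha$, $i=1,\dots,p$. -/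

import Mathlib

open MeasureTheory ProbabilityTheory
open scoped ENNReal BigOperators

namespace FracPH

/-! ### Mittag-Leffler distributions -/

/-- The two-parameter Mittag-Leffler function `E_{a,b}(z) = ∑ₖ zᵏ / Γ(a k + b)` (real argument). -/
noncomputable def mittagLeffler (a b z : ℝ) : ℝ :=
  ∑' k : ℕ, z ^ k / Real.Gamma (a * k + b)

/-- The density of the Mittag-Leffler distribution `ML(a, l)`, equal to
`l x^(a-1) E_{a,a}(-l x^a)` for `x > 0` and to `0` for `x ≤ 0`. -/
noncomputable def mlDensity (a l x : ℝ) : ℝ :=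
  if 0 < x then l * x ^ (a - 1) * mittagLeffler a a (-l * x ^ a) else 0

/-- The real random variable `Z` has the (real-valued) probability density `f`:
`f` is integrable and `P(Z ∈ B) = ∫_B f(x) dx` for every Borel set `B`. -/
def HasDensity {Ω : Type*} [MeasurableSpace Ω] (μ : Measure Ω) (Z : Ω → ℝ) (f : ℝ → ℝ) : Prop :=
  Integrable f ∧ ∀ B : Set ℝ, MeasurableSet B → μ.real (Z ⁻¹' B) = ∫ x in B, f x

/-- `Z` is `ML(a, l)`-distributed. -/
def IsMittagLeffler {Ω : Type*} [MeasurableSpace Ω] (μ : Measure Ω) (Z : Ω → ℝ) (a l : ℝ) : Prop :=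
  Measurable Z ∧ HasDensity μ Z (mlDensity a l)

/-! ### The embedded Markov chain

The state space `E = {1, …, p, p+1}` is `Fin (p + 1)`; the states `1, …, p` are the
`Fin.castSucc i` for `i : Fin p`, and `p + 1` is `Fin.last p`. -/

/-- `firstPassage Q j n i` is the probability that the chain with transition matrix `Q` started
in `i` visits `j` at time `n + 1` and at none of the times `1, …, n`. -/
noncomputable def firstPassage {m : ℕ} (Q : Matrix (Fin m) (Fin m) ℝ) (j : Fin m) :
    ℕ → Fin m → ℝ
  | 0, i => Q i j
  | n + 1, i => ∑ k ∈ Finset.univ.erase j, Q i k * firstPassage Q j n k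

/-- The state `i` is transient: the probability of ever returning to `i` is less than one. -/
def IsTransient {m : ℕ} (Q : Matrix (Fin m) (Fin m) ℝ) (i : Fin m) : Prop :=
  ∑' n : ℕ, ENNReal.ofReal (firstPassage Q i n i) < 1

/-- `Q` is the transition matrix of a Markov chain on `{1, …, p + 1}` whose first `p` states are
transient and have `q_{ii} = 0`, and whose state `p + 1` is absorbing. -/
structure IsAbsorbingTransitionMatrix {p : ℕ} (Q : Matrix (Fin (p + 1)) (Fin (p + 1)) ℝ) :
    Prop where
  nonneg : ∀ i j, 0 ≤ Q i j
  row_sum : ∀ i, ∑ j, Q i j = 1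
  absorbing : Q (Fin.last p) (Fin.last p) = 1
  transient : ∀ i : Fin p, IsTransient Q i.castSucc
  diag_zero : ∀ i : Fin p, Q i.castSucc i.castSucc = 0

/-- `C = (C₀, C₁, …)` is a Markov chain on `{1, …, m}` with initial distribution `v` and
transition matrix `Q`. -/
def IsMarkovChain {Ω : Type*} [MeasurableSpace Ω] (μ : Measure Ω) {m : ℕ}
    (v : Fin m → ℝ) (Q : Matrix (Fin m) (Fin m) ℝ) (C : ℕ → Ω → Fin m) : Prop :=
  (∀ n, Measurable (C n)) ∧
    ∀ (n : ℕ) (x : ℕ → Fin m),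
      μ.real {ω | ∀ k ≤ n, C k ω = x k} = v (x 0) * ∏ k ∈ Finset.range n, Q (x k) (x (k + 1))

/-- The initial distribution on `{1, …, p + 1}` which is `w` on `{1, …, p}` and gives no mass
to `p + 1`. -/
noncomputable def initialLaw {p : ℕ} (w : Fin p → ℝ) : Fin (p + 1) → ℝ :=
  Fin.lastCases 0 w

/-! ### The semi-Markov process -/

section Construction

variable {Ω : Type*} {p : ℕ} (C : ℕ → Ω → Fin (p + 1)) (Z : Fin p → ℕ → Ω → ℝ)

/-- The time spent in the state `C n` reached by the `n`-th jump: it is `Z i n` if `C n` is the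
transient state `i`, and infinite if `C n` is absorbing. -/
noncomputable def holdingTime (n : ℕ) (ω : Ω) : ℝ≥0∞ :=
  Fin.lastCases (motive := fun _ => ℝ≥0∞) ∞ (fun i => ENNReal.ofReal (Z i n ω)) (C n ω)

/-- The time `S n` of the `n`-th jump, `S 0 = 0`. -/
noncomputable def jumpTime (n : ℕ) (ω : Ω) : ℝ≥0∞ :=
  ∑ k ∈ Finset.range n, holdingTime C Z k ω

/-- The label in `{1, 2, …}` of a state: the labels of `Fin (p + 1)` are `1, …, p + 1`. -/
def label {m : ℕ} (i : Fin m) : ℕ := (i : ℕ) + 1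

open Classical in
/-- The process `X_t = ∑_{n ≥ 1} C_{n-1} 1{S_{n-1} ≤ t < S_n}`, `t ≥ 0`, with values in the labels
`1, …, p + 1`. At most one summand is nonzero. -/
noncomputable def semiMarkov (t : ℝ) (ω : Ω) : ℕ :=
  ∑' n : ℕ, if jumpTime C Z n ω ≤ ENNReal.ofReal t ∧ ENNReal.ofReal t < jumpTime C Z (n + 1) ω
    then label (C n ω) else 0

/-- The absorption time `inf {t ≥ 0 : X_t = p + 1}` (infinite if there is no such `t`). -/
noncomputable def absorptionTime (ω : Ω) : ℝ≥0∞ :=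
  ⨅ (t : ℝ) (_ : 0 ≤ t ∧ semiMarkov C Z t ω = label (Fin.last p)), ENNReal.ofReal t

/-- The total reward `∫₀^τ ∑ᵢ r_{ik} 1{X_t = i} dt`, where `τ` is the absorption time. -/
noncomputable def totalReward {n : ℕ} (R : Matrix (Fin p) (Fin n) ℝ) (k : Fin n) (ω : Ω) : ℝ :=
  ∫ t in (0 : ℝ)..(absorptionTime C Z ω).toReal,
    ∑ i : Fin p, R i k * (if semiMarkov C Z t ω = label i then 1 else 0)

end Construction

/-! ### The intensity matrix and its blocks -/

/-- The intensity matrix: `λᵢ q_{ij}` off the diagonal and `-λᵢ` on it in the rows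
`i ≤ p`; the row `p + 1` vanishes. -/
noncomputable def intensityMatrix {p : ℕ} (lam : Fin p → ℝ)
    (Q : Matrix (Fin (p + 1)) (Fin (p + 1)) ℝ) : Matrix (Fin (p + 1)) (Fin (p + 1)) ℝ :=
  Matrix.of fun i j => Fin.lastCases (motive := fun _ => ℝ) 0
    (fun i' => if i'.castSucc = j then -lam i' else lam i' * Q i'.castSucc j) i

/-- The block `T` of the intensity matrix (rows and columns `1, …, p`). -/
noncomputable def subIntensity {p : ℕ} (lam : Fin p → ℝ)
    (Q : Matrix (Fin (p + 1)) (Fin (p + 1)) ℝ) : Matrix (Fin p) (Fin p) ℝ :=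
  (intensityMatrix lam Q).submatrix Fin.castSucc Fin.castSucc

/-- The block `t` of the intensity matrix (rows `1, …, p`, column `p + 1`). -/
noncomputable def exitRates {p : ℕ} (lam : Fin p → ℝ)
    (Q : Matrix (Fin (p + 1)) (Fin (p + 1)) ℝ) : Fin p → ℝ :=
  fun i => intensityMatrix lam Q i.castSucc (Fin.last p)

end FracPH

open FracPH

namespace FracPH

/-! ### Laplace transform of the Mittag-Leffler distribution. -/

section

/-! Given the path of the chain, each reward is a linear combination of independent sojourn times.
So E exp(-⟨Y,θ⟩) is the expectation of a product of factors φ(C_k), where φ(i) = λ_i / (λ_i + d_i)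
with d_i = ((Rθ)_i)^α, and φ = 1 at the absorbing state. The function h equal to (Δ(Rθ)^α - T)⁻¹ t
on the transient states and to 1 at the absorbing one satisfies h = φ · Qh (`absorptionValue_eq`).
Hence E[∏_{k<M} φ(C_k) · h(C_M)] does not depend on M and equals πh. As M → ∞, absorption turns
h(C_M) into 1, and dominated convergence gives the formula.

Two ingredients carry this. The Laplace transform λ / (λ + u^α) (`IsMittagLeffler.integral_exp_neg`)
comes from termwise integration for large u and analytic continuation to all u > 0. The maximum
principle `IsAbsorbingTransitionMatrix.nonpos_of_subharmonic` yields both almost sure absorption and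
invertibility of Δ(Rθ)^α - T; it rests on `exists_not_isTransient`, which links the
return-probability definition of transience to the structure of a finite chain. -/

theorem analyticOnNhd_rpow_const (a : ℝ) :
    AnalyticOnNhd ℝ (fun u : ℝ => u ^ a) (Set.Ioi 0) := fun _ hu =>
  (Real.contDiffAt_rpow_const_of_ne (n := ⊤) (ne_of_gt hu)).analyticAt

theorem integrableOn_rpow_mul_exp_neg_mul {s u : ℝ} (hs : 0 < s) (hu : 0 < u) :
    IntegrableOn (fun x : ℝ => x ^ (s - 1) * Real.exp (-(u * x))) (Set.Ioi 0) := by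
  have h := integrableOn_rpow_mul_exp_neg_mul_rpow (p := 1) (s := s - 1) (b := u)
    (by linarith) one_pos hu
  simpa [Real.rpow_one, neg_mul] using h

/-- The Laplace transform of the Mittag-Leffler density at the points where the termwise
Laplace transform of the defining series converges. -/
theorem integral_exp_mul_mlDensity_of_lt {a l u : ℝ} (ha : 0 < a) (hl : 0 < l) (hu : 0 < u)
    (hlu : l < u ^ a) :
    ∫ x, mlDensity a l x * Real.exp (-(u * x)) = l / (l + u ^ a) := by
  have hua : 0 < u ^ a := Real.rpow_pos_of_pos hu a
  have hpos : ∀ k : ℕ, 0 < a * k + a := fun k => by positivity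
  set F : ℕ → ℝ → ℝ := fun k x =>
    (l * (-l) ^ k / Real.Gamma (a * k + a)) * (x ^ (a * k + a - 1) * Real.exp (-(u * x))) with hF
  have hint : ∀ k, IntegrableOn (F k) (Set.Ioi 0) := fun k =>
    (integrableOn_rpow_mul_exp_neg_mul (hpos k) hu).const_mul _
  have hval : ∀ k : ℕ, ∫ x in Set.Ioi 0, x ^ (a * k + a - 1) * Real.exp (-(u * x))
      = (1 / u ^ a) ^ (k + 1) * Real.Gamma (a * k + a) := fun k => by
    rw [Real.integral_rpow_mul_exp_neg_mul_Ioi (hpos k) hu]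
    congr 1
    rw [show a * (k : ℝ) + a = a * ((k + 1 : ℕ) : ℝ) by push_cast; ring,
      Real.rpow_mul (by positivity), Real.rpow_natCast, Real.div_rpow zero_le_one hu.le,
      Real.one_rpow]
  have hG : ∀ k : ℕ, 0 < Real.Gamma (a * k + a) := fun k => Real.Gamma_pos_of_pos (hpos k)
  have hFval : ∀ k, ∫ x in Set.Ioi 0, F k x = l / u ^ a * (-(l / u ^ a)) ^ k := fun k => by
    simp only [hF]
    rw [integral_const_mul, hval]
    have := (hG k).ne'
    rw [show -(l / u ^ a) = (-l) * (1 / u ^ a) by ring, mul_pow, pow_succ]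
    field_simp
  have hFnorm : ∀ k, ∫ x in Set.Ioi 0, ‖F k x‖ = l / u ^ a * (l / u ^ a) ^ k := fun k => by
    have : ∀ x ∈ Set.Ioi (0 : ℝ), ‖F k x‖ = (l * l ^ k / Real.Gamma (a * k + a)) *
        (x ^ (a * k + a - 1) * Real.exp (-(u * x))) := fun x hx => by
      have hx : 0 < x := hx
      simp only [hF, norm_mul, norm_div, norm_pow, norm_neg, Real.norm_eq_abs]
      rw [abs_of_pos hl, abs_of_pos (hG k), abs_of_pos (Real.rpow_pos_of_pos hx _),
        abs_of_pos (Real.exp_pos _)]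
    rw [setIntegral_congr_fun measurableSet_Ioi this, integral_const_mul, hval]
    have := (hG k).ne'
    rw [show l / u ^ a = l * (1 / u ^ a) by ring, mul_pow, pow_succ]
    field_simp
  have hq0 : 0 ≤ l / u ^ a := by positivity
  have hq1 : l / u ^ a < 1 := (div_lt_one hua).2 hlu
  -- The integrals of the norms form a geometric series of ratio l / u^a, so the exchange of sum and
  -- integral needs l < u^a.
  have hsum := hasSum_integral_of_summable_integral_norm (F := F) hint
    (by simp_rw [hFnorm]; exact (summable_geometric_of_lt_one hq0 hq1).mul_left _)
  simp_rw [hFval] at hsum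
  have hgeo := (hasSum_geometric_of_abs_lt_one (r := -(l / u ^ a))
    (by rwa [abs_neg, abs_of_nonneg hq0])).mul_left (l / u ^ a)
  have hdens : ∫ x, mlDensity a l x * Real.exp (-(u * x)) = ∫ x in Set.Ioi 0, ∑' k, F k x := by
    rw [← integral_indicator measurableSet_Ioi]
    congr 1
    ext x
    by_cases hx : 0 < x
    · rw [Set.indicator_of_mem (Set.mem_Ioi.2 hx), mlDensity, if_pos hx, mittagLeffler,
        ← tsum_mul_left, ← tsum_mul_right]
      congr 1
      ext k
      have hxk : x ^ (a * k + a - 1) = x ^ (a - 1) * (x ^ a) ^ k := by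
        rw [show a * (k : ℝ) + a - 1 = (a - 1) + a * k by ring, Real.rpow_add hx,
          Real.rpow_mul hx.le, Real.rpow_natCast]
      simp only [hF, hxk, mul_pow]
      ring
    · rw [Set.indicator_of_notMem (by simpa using hx), mlDensity, if_neg hx, zero_mul]
  rw [hdens, hsum.unique hgeo]
  field_simp
  rw [sub_neg_eq_add]
  field_simp
  rw [add_comm]

variable {Ω : Type*} [MeasurableSpace Ω] {μ : Measure Ω} [IsProbabilityMeasure μ]

/-- Nonnegativity of the density is not part of `HasDensity`; it follows because all its set
integrals are probabilities. -/
theorem HasDensity.map_eq {Z : Ω → ℝ} {f : ℝ → ℝ} (hZ : Measurable Z)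
    (h : HasDensity μ Z f) :
    0 ≤ᵐ[volume] f ∧ μ.map Z = volume.withDensity fun x => ENNReal.ofReal (f x) := by
  obtain ⟨hf, hB⟩ := h
  have h0 : 0 ≤ᵐ[volume] f := ae_nonneg_of_forall_setIntegral_nonneg hf fun s hs _ => by
    rw [← hB s hs]; exact measureReal_nonneg
  refine ⟨h0, Measure.ext fun s hs => ?_⟩
  rw [Measure.map_apply hZ hs, withDensity_apply _ hs,
    ← ofReal_integral_eq_lintegral_ofReal hf.integrableOn (ae_restrict_of_ae h0), ← hB s hs,
    ofReal_measureReal]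

theorem HasDensity.integral_comp {Z : Ω → ℝ} {f g : ℝ → ℝ} (hZ : Measurable Z)
    (h : HasDensity μ Z f) (hg : Measurable g) :
    ∫ ω, g (Z ω) ∂μ = ∫ x, f x * g x := by
  obtain ⟨h0, hmap⟩ := h.map_eq hZ
  rw [← integral_map hZ.aemeasurable hg.aestronglyMeasurable, hmap,
    integral_withDensity_eq_integral_toReal_smul₀ h.1.aemeasurable.ennreal_ofReal
      (by simp)]
  refine integral_congr_ae ?_
  filter_upwards [h0] with x hx
  rw [ENNReal.toReal_ofReal hx, smul_eq_mul]

theorem IsMittagLeffler.ae_pos {Z : Ω → ℝ} {a l : ℝ} (h : IsMittagLeffler μ Z a l) :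
    ∀ᵐ ω ∂μ, 0 < Z ω := by
  have h1 := h.2.2 (Set.Iic 0) measurableSet_Iic
  have h2 : ∫ x in Set.Iic 0, mlDensity a l x = 0 :=
    setIntegral_eq_zero_of_forall_eq_zero fun x hx => if_neg (not_lt.2 hx)
  rw [h2, measureReal_eq_zero_iff] at h1
  rw [ae_iff]
  simpa [Set.preimage, not_lt] using h1

/-- The Laplace transform of the Mittag-Leffler distribution. -/
theorem IsMittagLeffler.integral_exp_neg {Z : Ω → ℝ} {a l u : ℝ} (ha : 0 < a) (hl : 0 < l)
    (h : IsMittagLeffler μ Z a l) (hu : 0 ≤ u) :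
    ∫ ω, Real.exp (-(u * Z ω)) ∂μ = l / (l + u ^ a) := by
  rcases hu.eq_or_lt with rfl | hu
  · simp [Real.zero_rpow ha.ne', hl.ne']
  -- Since Z > 0 almost surely, exp(-tZ) ≤ 1 for t > 0, so the moment generating function of -Z is
  -- analytic on the whole half-line.
  have hset : Set.Ioi 0 ⊆ interior (integrableExpSet (fun ω => -Z ω) μ) := by
    refine isOpen_Ioi.subset_interior_iff.2 fun t ht => ?_
    have ht : 0 < t := ht
    refine Integrable.of_bound (C := 1) ?_ ?_
    · have := h.1; fun_prop
    · filter_upwards [h.ae_pos] with ω hω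
      rw [Real.norm_eq_abs, abs_of_pos (Real.exp_pos _), Real.exp_le_one_iff]
      nlinarith [mul_pos ht hω]
  have hmgf : AnalyticOnNhd ℝ (mgf (fun ω => -Z ω) μ) (Set.Ioi 0) :=
    analyticOnNhd_mgf.mono hset
  have hrat : AnalyticOnNhd ℝ (fun u : ℝ => l / (l + u ^ a)) (Set.Ioi 0) :=
    analyticOnNhd_const.div (analyticOnNhd_const.add (analyticOnNhd_rpow_const a))
      fun x hx => by
        have := Real.rpow_pos_of_pos (Set.mem_Ioi.1 hx) a
        positivity
  -- Near such a u₀ the termwise computation applies; the identity theorem spreads the equality to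
  -- all u > 0.
  obtain ⟨u₀, hu₀, hlu₀⟩ : ∃ u₀ : ℝ, 0 < u₀ ∧ l < u₀ ^ a :=
    ((Filter.eventually_gt_atTop 0).and
      ((tendsto_rpow_atTop ha).eventually_gt_atTop l)).exists
  have hev : mgf (fun ω => -Z ω) μ =ᶠ[nhds u₀] fun u => l / (l + u ^ a) := by
    have hcont : ContinuousAt (fun u : ℝ => u ^ a) u₀ :=
      Real.continuousAt_rpow_const _ _ (Or.inl hu₀.ne')
    filter_upwards [lt_mem_nhds hu₀, hcont.eventually (lt_mem_nhds hlu₀)] with v hv hlv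
    rw [← integral_exp_mul_mlDensity_of_lt ha hl hv hlv,
      ← h.2.integral_comp h.1 (g := fun x => Real.exp (-(v * x))) (by fun_prop)]
    simp [mgf]
  have := hmgf.eqOn_of_preconnected_of_eventuallyEq hrat isPreconnected_Ioi
    (Set.mem_Ioi.2 hu₀) hev (Set.mem_Ioi.2 hu)
  simpa [mgf] using this

end

/-! ### Transience, the maximum principle and the linear system. -/

section

variable {p : ℕ} {Q : Matrix (Fin (p + 1)) (Fin (p + 1)) ℝ}

theorem summable_firstPassage_of_isTransient {m : ℕ} {Q : Matrix (Fin m) (Fin m) ℝ}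
    (hQ : ∀ i j, 0 ≤ Q i j) {j : Fin m} (h : IsTransient Q j) :
    ∃ c < 1, ∀ N, ∑ n ∈ Finset.range N, firstPassage Q j n j ≤ c := by
  have h0 : ∀ n i, 0 ≤ firstPassage Q j n i := fun n => by
    induction n with
    | zero => intro i; exact hQ i j
    | succ n ih => intro i; exact Finset.sum_nonneg fun k _ => mul_nonneg (hQ i k) (ih k)
  refine ⟨(∑' n : ℕ, ENNReal.ofReal (firstPassage Q j n j)).toReal, ?_, fun N => ?_⟩
  · rw [← ENNReal.toReal_one]
    exact (ENNReal.toReal_lt_toReal h.ne_top ENNReal.one_ne_top).2 h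
  · rw [← ENNReal.ofReal_le_iff_le_toReal h.ne_top,
      ENNReal.ofReal_sum_of_nonneg fun n _ => h0 n j]
    exact ENNReal.sum_le_tsum _

/-- A convex combination of numbers `v k ≤ M` which is at least `M` only charges the `k` with
`v k = M`. -/
theorem eq_of_le_sum_mul {ι : Type*} [Fintype ι] {q v : ι → ℝ} {M : ℝ} (hq : ∀ k, 0 ≤ q k)
    (hq1 : ∑ k, q k = 1) (hv : ∀ k, 0 < q k → v k ≤ M) (h : M ≤ ∑ k, q k * v k)
    {k : ι} (hk : 0 < q k) : v k = M := by
  have h1 : ∑ k, q k * (M - v k) ≤ 0 := by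
    simp_rw [mul_sub, Finset.sum_sub_distrib, ← Finset.sum_mul, hq1]
    linarith
  have h0 : ∀ k ∈ Finset.univ, 0 ≤ q k * (M - v k) := fun k _ => by
    rcases (hq k).eq_or_lt with h | h
    · simp [← h]
    · exact mul_nonneg h.le (sub_nonneg.2 (hv k h))
  have := (Finset.sum_eq_zero_iff_of_nonneg h0).1 (le_antisymm h1 (Finset.sum_nonneg h0)) k
    (Finset.mem_univ k)
  rcases mul_eq_zero.1 this with h | h <;> linarith

/-- A finite set of states that the chain cannot leave. -/
def IsClosedSet {m : ℕ} (Q : Matrix (Fin m) (Fin m) ℝ) (B : Finset (Fin m)) : Prop :=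
  ∀ i ∈ B, ∀ j, 0 < Q i j → j ∈ B

/-- A nonempty finite closed set contains a state that is not transient. -/
theorem exists_not_isTransient {m : ℕ} {Q : Matrix (Fin m) (Fin m) ℝ}
    (hQ : ∀ i j, 0 ≤ Q i j) (hQ1 : ∀ i, ∑ j, Q i j = 1) {B : Finset (Fin m)}
    (hB : IsClosedSet Q B) (hne : B.Nonempty) : ∃ i ∈ B, ¬ IsTransient Q i := by
  classical
  induction B using Finset.strongInduction with
  | H B ih =>
  obtain ⟨i, hi⟩ := hne
  by_cases hmin : ∃ B' ⊂ B, IsClosedSet Q B' ∧ B'.Nonempty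
  · obtain ⟨B', hsub, hcl, hne'⟩ := hmin
    obtain ⟨j, hj, hjt⟩ := ih B' hsub hcl hne'
    exact ⟨j, hsub.1 hj, hjt⟩
  -- B is now a minimal nonempty closed set. If i were transient, the states of B other than i that
  -- maximize the probability of never visiting i would form a smaller one.
  refine ⟨i, hi, fun hti => ?_⟩
  obtain ⟨c, hc1, hc⟩ := summable_firstPassage_of_isTransient hQ hti
  -- Probability that the chain from j avoids i at times 1, …, N; the recursion `hrec` conditions on
  -- the first step.
  set u : ℕ → Fin m → ℝ := fun N j => 1 - ∑ n ∈ Finset.range N, firstPassage Q i n j with hu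
  have hrec : ∀ N j, u (N + 1) j = ∑ k, Q j k * (if k = i then 0 else u N k) := fun N j => by
    have hsplit : ∀ f : Fin m → ℝ, ∑ k, Q j k * (if k = i then 0 else f k)
        = ∑ k ∈ Finset.univ.erase i, Q j k * f k := fun f => by
      rw [← Finset.add_sum_erase _ _ (Finset.mem_univ i)]
      simp only [if_true, mul_zero, zero_add]
      exact Finset.sum_congr rfl fun k hk => by rw [if_neg (Finset.ne_of_mem_erase hk)]
    have h1 := hQ1 j
    rw [← Finset.add_sum_erase _ _ (Finset.mem_univ i)] at h1
    rw [hsplit]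
    simp only [hu, Finset.sum_range_succ', firstPassage, mul_sub, Finset.sum_sub_distrib,
      mul_one, Finset.mul_sum]
    rw [Finset.sum_comm]
    linarith
  have hnonneg : ∀ N j, 0 ≤ u N j := fun N => by
    induction N with
    | zero => intro j; simp [hu]
    | succ N ihN =>
      intro j
      rw [hrec]
      refine Finset.sum_nonneg fun k _ => mul_nonneg (hQ j k) ?_
      split_ifs
      exacts [le_rfl, ihN k]
  have hanti : ∀ j, Antitone fun N => u N j := fun j => antitone_nat_of_succ_le fun N => by
    induction N generalizing j with
    | zero =>
      rw [hrec, show u 0 j = ∑ k, Q j k by simp [hu, hQ1]]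
      refine Finset.sum_le_sum fun k _ => mul_le_of_le_one_right (hQ j k) ?_
      split_ifs
      exacts [zero_le_one, by simp [hu]]
    | succ N ihN =>
      rw [hrec, hrec]
      refine Finset.sum_le_sum fun k _ => mul_le_mul_of_nonneg_left ?_ (hQ j k)
      split_ifs
      exacts [le_rfl, ihN k]
  set U : Fin m → ℝ := fun j => ⨅ N, u N j with hU
  have hlim : ∀ j, Filter.Tendsto (fun N => u N j) Filter.atTop (nhds (U j)) := fun j =>
    tendsto_atTop_ciInf (hanti j) ⟨0, by rintro _ ⟨N, rfl⟩; exact hnonneg N j⟩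
  have hU0 : ∀ j, 0 ≤ U j := fun j => ge_of_tendsto' (hlim j) fun N => hnonneg N j
  have hUrec : ∀ j, U j = ∑ k, Q j k * (if k = i then 0 else U k) := fun j => by
    refine tendsto_nhds_unique ((Filter.tendsto_add_atTop_iff_nat 1).2 (hlim j)) ?_
    simp_rw [hrec]
    refine tendsto_finsetSum _ fun k _ => Filter.Tendsto.const_mul _ ?_
    split_ifs
    exacts [tendsto_const_nhds, hlim k]
  have hUi : 0 < U i := lt_of_lt_of_le (by linarith : 0 < 1 - c)
    (ge_of_tendsto' (hlim i) fun N => by simp only [hu]; linarith [hc N])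
  obtain ⟨j₀, hj₀, hmax⟩ := B.exists_max_image U ⟨i, hi⟩
  have hM : 0 < U j₀ := hUi.trans_le (hmax i hi)
  -- At a maximizer the average over successors attains the positive maximum, while i contributes 0:
  -- so i is no successor and every successor is a maximizer.
  have hstep : ∀ j ∈ B, U j = U j₀ → ∀ k, 0 < Q j k → k ≠ i ∧ U k = U j₀ := by
    intro j hj hUj k hk
    have := eq_of_le_sum_mul (M := U j₀) (hQ j) (hQ1 j)
      (v := fun k => if k = i then 0 else U k)
      (fun k hk => by
        split_ifs
        exacts [hM.le, hmax k (hB j hj k hk)])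
      (by rw [← hUrec, hUj]) hk
    split_ifs at this with h
    · exact absurd this hM.ne
    · exact ⟨h, this⟩
  have hclosed : IsClosedSet Q (B.filter fun j => j ≠ i ∧ U j = U j₀) := by
    intro j hj k hk
    simp only [Finset.mem_filter] at hj ⊢
    exact ⟨hB j hj.1 k hk, hstep j hj.1 hj.2.2 k hk⟩
  refine hmin ⟨_, ?_, hclosed, ?_⟩
  · refine Finset.filter_ssubset.2 ⟨i, hi, by simp⟩
  -- The maximizer j₀ may be i itself, so a successor of j₀ serves as witness.
  · obtain ⟨k, -, hk⟩ : ∃ k ∈ Finset.univ, 0 < Q j₀ k := by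
      by_contra! hcon
      have := Finset.sum_nonpos hcon
      rw [hQ1] at this
      linarith
    exact ⟨k, Finset.mem_filter.2 ⟨hB j₀ hj₀ k hk, hstep j₀ hj₀ rfl k hk⟩⟩

/-- Maximum principle: a function which vanishes at the absorbing state and is subharmonic at
the transient states is nonpositive. -/
theorem IsAbsorbingTransitionMatrix.nonpos_of_subharmonic (hQ : IsAbsorbingTransitionMatrix Q)
    {v : Fin (p + 1) → ℝ} (hlast : v (Fin.last p) = 0)
    (hsub : ∀ i : Fin p, v i.castSucc ≤ ∑ j, Q i.castSucc j * v j) (j : Fin (p + 1)) :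
    v j ≤ 0 := by
  classical
  by_contra! hj
  obtain ⟨j₀, -, hmax⟩ := Finset.univ.exists_max_image v ⟨j, Finset.mem_univ j⟩
  have hM : 0 < v j₀ := hj.trans_le (hmax j (Finset.mem_univ j))
  -- With a positive maximum the maximizers avoid the absorbing state, so this closed set would
  -- consist of transient states only.
  have hcl : IsClosedSet Q (Finset.univ.filter fun j => v j = v j₀) := by
    intro i hi k hk
    simp only [Finset.mem_filter, Finset.mem_univ, true_and] at hi ⊢
    induction i using Fin.lastCases with
    | last => rw [hlast] at hi; exact absurd hi hM.ne
    | cast i =>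
      exact eq_of_le_sum_mul (hQ.nonneg _) (hQ.row_sum _)
        (fun k _ => hmax k (Finset.mem_univ k)) (hi ▸ hsub i) hk
  obtain ⟨i, hi, hit⟩ := exists_not_isTransient hQ.nonneg hQ.row_sum hcl ⟨j₀, by simp⟩
  induction i using Fin.lastCases with
  | last => simp only [Finset.mem_filter, hlast] at hi; exact hM.ne hi.2
  | cast i => exact hit (hQ.transient i)

/-- The probability that the chain started in the given state is not absorbed by time `n`. -/
noncomputable def survival (Q : Matrix (Fin (p + 1)) (Fin (p + 1)) ℝ) :
    ℕ → Fin (p + 1) → ℝ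
  | 0, i => if i = Fin.last p then 0 else 1
  | n + 1, i => ∑ j, Q i j * survival Q n j

theorem IsAbsorbingTransitionMatrix.last_ne (hQ : IsAbsorbingTransitionMatrix Q) {j : Fin (p + 1)}
    (hj : j ≠ Fin.last p) : Q (Fin.last p) j = 0 := by
  have h := hQ.row_sum (Fin.last p)
  rw [← Finset.add_sum_erase _ _ (Finset.mem_univ (Fin.last p)), hQ.absorbing,
    add_eq_left, Finset.sum_eq_zero_iff_of_nonneg fun k _ => hQ.nonneg _ k] at h
  exact h j (Finset.mem_erase.2 ⟨hj, Finset.mem_univ j⟩)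

theorem IsAbsorbingTransitionMatrix.sum_last (hQ : IsAbsorbingTransitionMatrix Q)
    (v : Fin (p + 1) → ℝ) : ∑ j, Q (Fin.last p) j * v j = v (Fin.last p) := by
  rw [Finset.sum_eq_single (Fin.last p) (fun j _ hj => by rw [hQ.last_ne hj, zero_mul])
    (by simp), hQ.absorbing, one_mul]

/-- Survival probabilities decrease in n; their limit is harmonic and zero at the absorbing state,
so the maximum principle kills it. -/
theorem IsAbsorbingTransitionMatrix.tendsto_survival (hQ : IsAbsorbingTransitionMatrix Q)
    (i : Fin (p + 1)) :
    Filter.Tendsto (fun n => survival Q n i) Filter.atTop (nhds 0) := by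
  have hnonneg : ∀ n i, 0 ≤ survival Q n i := fun n => by
    induction n with
    | zero => intro i; simp only [survival]; split_ifs <;> norm_num
    | succ n ih => intro i; exact Finset.sum_nonneg fun k _ => mul_nonneg (hQ.nonneg i k) (ih k)
  have hlast : ∀ n, survival Q n (Fin.last p) = 0 := fun n => by
    induction n with
    | zero => simp [survival]
    | succ n ih => rw [survival, hQ.sum_last, ih]
  have hanti : ∀ i, Antitone fun n => survival Q n i := fun i =>
    antitone_nat_of_succ_le fun n => by
      induction n generalizing i with
      | zero =>
        by_cases hi : i = Fin.last p
        · rw [hi, hlast, hlast]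
        · rw [survival, survival, if_neg hi, ← hQ.row_sum i]
          refine Finset.sum_le_sum fun k _ => mul_le_of_le_one_right (hQ.nonneg i k) ?_
          simp only [survival]
          split_ifs <;> norm_num
      | succ n ih =>
        rw [survival, survival]
        exact Finset.sum_le_sum fun k _ => mul_le_mul_of_nonneg_left (ih k) (hQ.nonneg i k)
  set U : Fin (p + 1) → ℝ := fun j => ⨅ n, survival Q n j with hU
  have hlim : ∀ j, Filter.Tendsto (fun n => survival Q n j) Filter.atTop (nhds (U j)) := fun j =>
    tendsto_atTop_ciInf (hanti j) ⟨0, by rintro _ ⟨N, rfl⟩; exact hnonneg N j⟩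
  have hUrec : ∀ j, U j = ∑ k, Q j k * U k := fun j =>
    tendsto_nhds_unique ((Filter.tendsto_add_atTop_iff_nat 1).2 (hlim j))
      (tendsto_finsetSum _ fun k _ => (hlim k).const_mul _)
  have h := hQ.nonpos_of_subharmonic (v := U) (by simp [hU, hlast]) (fun i => (hUrec _).le) i
  have h0 : U i = 0 := le_antisymm h (ge_of_tendsto' (hlim i) fun n => hnonneg n i)
  exact h0 ▸ hlim i

/-- Because q_ii = 0, the diagonal entry -λ_i equals λ_i (q_ii - 1), so T is diag(λ) times (Q - I)
restricted to the transient states. -/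
theorem subIntensity_mulVec (hQ : IsAbsorbingTransitionMatrix Q) (lam : Fin p → ℝ)
    (v : Fin p → ℝ) (i : Fin p) :
    (subIntensity lam Q).mulVec v i
      = lam i * ∑ j : Fin p, Q i.castSucc j.castSucc * v j - lam i * v i := by
  have hentry : ∀ j, subIntensity lam Q i j
      = lam i * Q i.castSucc j.castSucc - if j = i then lam i else 0 := fun j => by
    simp only [subIntensity, intensityMatrix, Matrix.submatrix_apply, Matrix.of_apply,
      Fin.lastCases_castSucc, Fin.castSucc_inj]
    by_cases h : i = j
    · subst h; simp [hQ.diag_zero]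
    · simp [h, Ne.symm h]
  simp only [Matrix.mulVec, dotProduct, hentry, sub_mul, Finset.sum_sub_distrib, ite_mul,
    zero_mul, Finset.sum_ite_eq', Finset.mem_univ, if_true, Finset.mul_sum, mul_assoc]

/-- For v in the kernel, |v| extended by 0 is subharmonic, as d ≥ 0 only helps; the maximum
principle gives v = 0. The case d = 0 is included. -/
theorem isUnit_diagonal_sub_subIntensity (hQ : IsAbsorbingTransitionMatrix Q)
    {lam d : Fin p → ℝ} (hlam : ∀ i, 0 < lam i) (hd : ∀ i, 0 ≤ d i) :
    IsUnit (Matrix.diagonal d - subIntensity lam Q) := by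
  rw [← Matrix.mulVec_injective_iff_isUnit, ← Matrix.coe_mulVecLin, ← LinearMap.ker_eq_bot,
    LinearMap.ker_eq_bot']
  intro v hv
  have hrow : ∀ i, (d i + lam i) * v i = lam i * ∑ j : Fin p, Q i.castSucc j.castSucc * v j := by
    intro i
    have := congrFun hv i
    rw [Matrix.mulVecLin_apply, Matrix.sub_mulVec, Pi.sub_apply, Matrix.mulVec_diagonal,
      subIntensity_mulVec hQ, Pi.zero_apply] at this
    linarith
  have h := hQ.nonpos_of_subharmonic (v := Fin.lastCases 0 fun i => |v i|) (by simp) fun i => by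
    rw [Fin.sum_univ_castSucc]
    simp only [Fin.lastCases_castSucc, Fin.lastCases_last, mul_zero, add_zero]
    have h1 : lam i * |v i| ≤ lam i * ∑ j : Fin p, Q i.castSucc j.castSucc * |v j| := by
      calc lam i * |v i| ≤ (d i + lam i) * |v i| :=
            mul_le_mul_of_nonneg_right (by linarith [hd i]) (abs_nonneg _)
        _ = |(d i + lam i) * v i| := by
            rw [abs_mul, abs_of_pos (show 0 < d i + lam i by linarith [hd i, hlam i])]
        _ = lam i * |∑ j : Fin p, Q i.castSucc j.castSucc * v j| := by
            rw [hrow, abs_mul, abs_of_pos (hlam i)]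
        _ ≤ _ := by
            refine mul_le_mul_of_nonneg_left ?_ (hlam i).le
            refine (Finset.abs_sum_le_sum_abs _ _).trans_eq (Finset.sum_congr rfl fun j _ => ?_)
            rw [abs_mul, abs_of_nonneg (hQ.nonneg _ _)]
    exact le_of_mul_le_mul_left h1 (hlam i)
  ext i
  have := h i.castSucc
  simp only [Fin.lastCases_castSucc] at this
  exact abs_nonpos_iff.1 this

/-- The value function: `(D - T)⁻¹ t` at the transient states, `1` at the absorbing state. -/
noncomputable def absorptionValue (lam d : Fin p → ℝ)
    (Q : Matrix (Fin (p + 1)) (Fin (p + 1)) ℝ) : Fin (p + 1) → ℝ :=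
  Fin.lastCases 1
    ((Matrix.diagonal d - subIntensity lam Q)⁻¹.mulVec (exitRates lam Q))

/-- Row i of (D - T)h = t reads (λ_i + d_i) h_i = λ_i ∑_j q_ij h_j once h = 1 at the absorbing state
absorbs the exit rate into the sum. -/
theorem absorptionValue_eq (hQ : IsAbsorbingTransitionMatrix Q)
    {lam d : Fin p → ℝ} (hlam : ∀ i, 0 < lam i) (hd : ∀ i, 0 ≤ d i) (i : Fin (p + 1)) :
    (Fin.lastCases (motive := fun _ => ℝ) 1 (fun i => lam i / (lam i + d i)) i)
      * ∑ j, Q i j * absorptionValue lam d Q j = absorptionValue lam d Q i := by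
  induction i using Fin.lastCases with
  | last => simp [hQ.sum_last]
  | cast i =>
    have hunit := isUnit_diagonal_sub_subIntensity hQ hlam hd
    set h := (Matrix.diagonal d - subIntensity lam Q)⁻¹.mulVec (exitRates lam Q) with hh
    have hsol : (Matrix.diagonal d - subIntensity lam Q).mulVec h = exitRates lam Q := by
      rw [hh, Matrix.mulVec_mulVec,
        Matrix.mul_nonsing_inv _ ((Matrix.isUnit_iff_isUnit_det _).1 hunit), Matrix.one_mulVec]
    have hi := congrFun hsol i
    have hex : exitRates lam Q i = lam i * Q i.castSucc (Fin.last p) := by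
      simp [exitRates, intensityMatrix, Fin.castSucc_ne_last]
    rw [Matrix.sub_mulVec, Pi.sub_apply, Matrix.mulVec_diagonal, subIntensity_mulVec hQ, hex] at hi
    rw [Fin.sum_univ_castSucc]
    simp only [absorptionValue, Fin.lastCases_castSucc, Fin.lastCases_last, mul_one, ← hh]
    have : lam i + d i ≠ 0 := by linarith [hlam i, hd i]
    field_simp
    linarith

/-- Summing the weights of all paths of length `n` started in `i` gives the `n`-th iterate of
the operator. -/
theorem sum_path_eq_iterate {m : ℕ} (A : Matrix (Fin m) (Fin m) ℝ) (g : ℕ → Fin m → ℝ)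
    (hg : ∀ n i, g (n + 1) i = ∑ j, A i j * g n j) (v : Fin m → ℝ) (n : ℕ) :
    ∑ x : Fin (n + 1) → Fin m,
        v (x 0) * (∏ k : Fin n, A (x k.castSucc) (x k.succ)) * g 0 (x (Fin.last n))
      = ∑ i, v i * g n i := by
  -- After the first state i is split off, the row A i plays the role of the initial vector for the
  -- remaining path.
  induction n generalizing v with
  | zero =>
    rw [← (Equiv.funUnique (Fin 1) (Fin m)).symm.sum_comp]
    simp [Equiv.funUnique]
  | succ n ih =>
    rw [← (Fin.consEquiv fun _ => Fin m).sum_comp, Fintype.sum_prod_type]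
    refine Finset.sum_congr rfl fun i _ => ?_
    rw [hg, ← ih (A i), Finset.mul_sum]
    refine Finset.sum_congr rfl fun x _ => ?_
    simp only [Fin.consEquiv_apply, Fin.prod_univ_succ, Fin.cons_zero, Fin.castSucc_zero,
      Fin.cons_succ, ← Fin.succ_last, ← Fin.succ_castSucc]
    ring

end

/-! ### Pathwise evaluation of the absorption time and the rewards. -/

section Pathwise

variable {Ω : Type*} {p : ℕ} {C : ℕ → Ω → Fin (p + 1)} {Z : Fin p → ℕ → Ω → ℝ} {ω : Ω}
  {N : ℕ}

/-- The time spent in the state `C k`, or `0` if that state is absorbing. -/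
noncomputable def sojourn (C : ℕ → Ω → Fin (p + 1)) (Z : Fin p → ℕ → Ω → ℝ) (k : ℕ) (ω : Ω) : ℝ :=
  Fin.lastCases (motive := fun _ => ℝ) 0 (fun i => Z i k ω) (C k ω)

/-- The path of the chain stays in the transient states before time `N` and is absorbed from
time `N` on, and all the variables `Z` are positive. -/
structure AbsorbedAt (C : ℕ → Ω → Fin (p + 1)) (Z : Fin p → ℕ → Ω → ℝ) (ω : Ω) (N : ℕ) :
    Prop where
  before : ∀ k < N, C k ω ≠ Fin.last p
  after : ∀ k, N ≤ k → C k ω = Fin.last p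
  pos : ∀ i k, 0 < Z i k ω


theorem AbsorbedAt.sojourn_pos (h : AbsorbedAt C Z ω N) {k : ℕ} (hk : k < N) :
    0 < sojourn C Z k ω := by
  obtain ⟨i, hi⟩ := Fin.exists_castSucc_eq.2 (h.before k hk)
  simp [sojourn, ← hi, h.pos]

theorem AbsorbedAt.holdingTime_eq (h : AbsorbedAt C Z ω N) {k : ℕ} (hk : k < N) :
    holdingTime C Z k ω = ENNReal.ofReal (sojourn C Z k ω) := by
  obtain ⟨i, hi⟩ := Fin.exists_castSucc_eq.2 (h.before k hk)
  simp [sojourn, holdingTime, ← hi]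

theorem AbsorbedAt.jumpTime_eq (h : AbsorbedAt C Z ω N) {n : ℕ} (hn : n ≤ N) :
    jumpTime C Z n ω = ENNReal.ofReal (∑ k ∈ Finset.range n, sojourn C Z k ω) := by
  have hlt : ∀ k ∈ Finset.range n, k < N := fun k hk => (Finset.mem_range.1 hk).trans_le hn
  rw [jumpTime, ENNReal.ofReal_sum_of_nonneg fun k hk => (h.sojourn_pos (hlt k hk)).le]
  exact Finset.sum_congr rfl fun k hk => h.holdingTime_eq (hlt k hk)

theorem AbsorbedAt.jumpTime_succ_eq_top (h : AbsorbedAt C Z ω N) :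
    jumpTime C Z (N + 1) ω = ∞ := by
  rw [jumpTime, Finset.sum_range_succ, holdingTime, h.after N le_rfl]
  simp

theorem jumpTime_mono : Monotone fun n => jumpTime C Z n ω := fun _ _ hmn =>
  Finset.sum_le_sum_of_subset (Finset.range_mono hmn)

theorem semiMarkov_eq {m : ℕ} {t : ℝ} (h1 : jumpTime C Z m ω ≤ ENNReal.ofReal t)
    (h2 : ENNReal.ofReal t < jumpTime C Z (m + 1) ω) :
    semiMarkov C Z t ω = label (C m ω) := by
  rw [semiMarkov, tsum_eq_single m, if_pos ⟨h1, h2⟩]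
  intro n hn
  refine if_neg fun ⟨h3, h4⟩ => ?_
  rcases hn.lt_or_gt with h | h
  · exact absurd (h4.trans_le (jumpTime_mono (Nat.succ_le_of_lt h))) (not_lt.2 h1)
  · exact absurd (h2.trans_le (jumpTime_mono (Nat.succ_le_of_lt h))) (not_lt.2 h3)

theorem AbsorbedAt.sum_sojourn_nonneg (h : AbsorbedAt C Z ω N) {n : ℕ} (hn : n ≤ N) :
    0 ≤ ∑ k ∈ Finset.range n, sojourn C Z k ω :=
  Finset.sum_nonneg fun _ hk => (h.sojourn_pos ((Finset.mem_range.1 hk).trans_le hn)).le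

theorem AbsorbedAt.semiMarkov_eq_of_lt (h : AbsorbedAt C Z ω N) {m : ℕ} (hm : m < N) {t : ℝ}
    (h1 : ∑ k ∈ Finset.range m, sojourn C Z k ω ≤ t)
    (h2 : t < ∑ k ∈ Finset.range (m + 1), sojourn C Z k ω) :
    semiMarkov C Z t ω = label (C m ω) := by
  refine semiMarkov_eq ?_ ?_
  · rw [h.jumpTime_eq hm.le]
    exact ENNReal.ofReal_le_ofReal h1
  · rw [h.jumpTime_eq hm]
    exact (ENNReal.ofReal_lt_ofReal_iff (((h.sum_sojourn_nonneg hm.le).trans h1).trans_lt h2)).2 h2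

theorem label_injective {m : ℕ} : Function.Injective (label : Fin m → ℕ) := fun _ _ h =>
  Fin.ext (Nat.succ_injective h)

theorem AbsorbedAt.absorptionTime_eq (h : AbsorbedAt C Z ω N) :
    absorptionTime C Z ω = ENNReal.ofReal (∑ k ∈ Finset.range N, sojourn C Z k ω) := by
  refine le_antisymm ?_ ?_
  · refine iInf₂_le _ ⟨h.sum_sojourn_nonneg le_rfl, ?_⟩
    rw [← h.after N le_rfl]
    refine semiMarkov_eq (h.jumpTime_eq le_rfl).le ?_
    rw [h.jumpTime_succ_eq_top]
    exact ENNReal.ofReal_lt_top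
  · refine le_iInf₂ fun t ⟨ht0, ht⟩ => ENNReal.ofReal_le_ofReal ?_
    by_contra! hlt
    -- The least such n locates the sojourn interval of t, which belongs to a transient state.
    have hex : ∃ n, t < ∑ k ∈ Finset.range n, sojourn C Z k ω := ⟨N, hlt⟩
    classical
    obtain ⟨m, hm⟩ : ∃ m, Nat.find hex = m + 1 := Nat.exists_eq_succ_of_ne_zero fun h0 => by
      have := Nat.find_spec hex
      rw [h0, Finset.sum_range_zero] at this
      exact absurd this (not_lt.2 ht0)
    have hmN : m < N := by
      have := Nat.find_min' hex hlt
      omega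
    have h1 := not_lt.1 (Nat.find_min hex (m := m) (by omega))
    have h2 := Nat.find_spec hex
    rw [hm] at h2
    rw [h.semiMarkov_eq_of_lt hmN h1 h2] at ht
    exact h.before m hmN (label_injective ht)

/-- The reward rate of a state, `0` for the absorbing one. -/
noncomputable def rewardRate {n : ℕ} (R : Matrix (Fin p) (Fin n) ℝ) (k : Fin n) :
    Fin (p + 1) → ℝ :=
  Fin.lastCases 0 fun i => R i k

theorem sum_mul_ite_label_eq {n : ℕ} (R : Matrix (Fin p) (Fin n) ℝ) (k : Fin n)
    (j : Fin (p + 1)) :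
    ∑ i : Fin p, R i k * (if label j = label i then 1 else 0) = rewardRate R k j := by
  induction j using Fin.lastCases with
  | last =>
    rw [rewardRate, Fin.lastCases_last]
    refine Finset.sum_eq_zero fun i _ => ?_
    rw [if_neg, mul_zero]
    simp only [label, Fin.val_last]
    omega
  | cast j =>
    rw [rewardRate, Fin.lastCases_castSucc]
    have : ∀ i : Fin p, (label j.castSucc = label i) ↔ j = i := fun i => by
      rw [← label_injective.eq_iff]; rfl
    simp [this]

/-- The integrand is constant on each open interval between consecutive jumps, so the integral
splits at the jump times. -/
theorem AbsorbedAt.totalReward_eq (h : AbsorbedAt C Z ω N) {n : ℕ}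
    (R : Matrix (Fin p) (Fin n) ℝ) (k : Fin n) :
    totalReward C Z R k ω
      = ∑ m ∈ Finset.range N, rewardRate R k (C m ω) * sojourn C Z m ω := by
  set s : ℕ → ℝ := fun m => ∑ k ∈ Finset.range m, sojourn C Z k ω with hs
  have hle : ∀ m < N, s m ≤ s (m + 1) := fun m hm => by
    simp only [hs, Finset.sum_range_succ]
    linarith [h.sojourn_pos hm]
  have heq : ∀ m < N, Set.EqOn (fun _ => rewardRate R k (C m ω))
      (fun t => ∑ i : Fin p, R i k * (if semiMarkov C Z t ω = label i then 1 else 0))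
      (Set.Ioo (s m) (s (m + 1))) := fun m hm t ht => by
    dsimp only
    rw [h.semiMarkov_eq_of_lt hm ht.1.le ht.2, sum_mul_ite_label_eq]
  have hsum := intervalIntegral.sum_integral_adjacent_intervals (μ := volume) (a := s) (n := N)
    (f := fun t => ∑ i : Fin p, R i k * (if semiMarkov C Z t ω = label i then 1 else 0))
    fun m hm => IntervalIntegrable.congr_uIoo intervalIntegrable_const
      (by rw [Set.uIoo_of_le (hle m hm)]; exact heq m hm)
  rw [show s 0 = 0 by simp [hs]] at hsum
  rw [totalReward, h.absorptionTime_eq, ENNReal.toReal_ofReal (h.sum_sojourn_nonneg le_rfl),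
    ← hsum]
  refine Finset.sum_congr rfl fun m hm => ?_
  have hm := Finset.mem_range.1 hm
  rw [← intervalIntegral.integral_congr_Ioo_of_le (hle m hm) (heq m hm),
    intervalIntegral.integral_const, smul_eq_mul, mul_comm]
  simp [hs, Finset.sum_range_succ]

/-- Replaces the random number N of sojourns by any larger M, so that a deterministic M can tend to
infinity. -/
theorem AbsorbedAt.totalReward_eq_of_le (h : AbsorbedAt C Z ω N) {n : ℕ}
    (R : Matrix (Fin p) (Fin n) ℝ) (k : Fin n) {M : ℕ} (hM : N ≤ M) :
    totalReward C Z R k ω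
      = ∑ m ∈ Finset.range M, rewardRate R k (C m ω) * sojourn C Z m ω := by
  rw [h.totalReward_eq]
  refine Finset.sum_subset (Finset.range_mono hM) fun m _ hm => ?_
  rw [h.after m (not_lt.1 (by simpa using hm)), rewardRate, Fin.lastCases_last, zero_mul]

/-- The Laplace factor of the `m`-th sojourn if it is spent in the given state. -/
noncomputable def laplaceFactor (Z : Fin p → ℕ → Ω → ℝ) (b : Fin p → ℝ) (m : ℕ) (ω : Ω) :
    Fin (p + 1) → ℝ :=
  Fin.lastCases 1 fun i => Real.exp (-(b i * Z i m ω))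

theorem laplaceFactor_castSucc (Z : Fin p → ℕ → Ω → ℝ) (b : Fin p → ℝ) (k : ℕ) (ω : Ω)
    (i : Fin p) : laplaceFactor Z b k ω i.castSucc = Real.exp (-(b i * Z i k ω)) := by
  simp [laplaceFactor]

theorem laplaceFactor_last (Z : Fin p → ℕ → Ω → ℝ) (b : Fin p → ℝ) (k : ℕ) (ω : Ω) :
    laplaceFactor Z b k ω (Fin.last p) = 1 := by
  simp [laplaceFactor]

theorem abs_laplaceFactor_le_one {Z : Fin p → ℕ → Ω → ℝ} {ω : Ω} (hZ : ∀ i k, 0 < Z i k ω)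
    {b : Fin p → ℝ} (hb : ∀ i, 0 ≤ b i) (k : ℕ) (j : Fin (p + 1)) :
    |laplaceFactor Z b k ω j| ≤ 1 := by
  induction j using Fin.lastCases with
  | last => simp [laplaceFactor_last]
  | cast i =>
    rw [laplaceFactor_castSucc, abs_of_pos (Real.exp_pos _), Real.exp_le_one_iff, neg_nonpos]
    exact mul_nonneg (hb i) (hZ i k).le

theorem AbsorbedAt.exp_neg_totalReward (h : AbsorbedAt C Z ω N) {n : ℕ}
    (R : Matrix (Fin p) (Fin n) ℝ) (θ : Fin n → ℝ) {M : ℕ} (hM : N ≤ M) :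
    Real.exp (-∑ k, totalReward C Z R k ω * θ k)
      = ∏ m ∈ Finset.range M, laplaceFactor Z (R.mulVec θ) m ω (C m ω) := by
  simp_rw [h.totalReward_eq_of_le R _ hM, Finset.sum_mul]
  rw [Finset.sum_comm, ← Finset.sum_neg_distrib, Real.exp_sum]
  refine Finset.prod_congr rfl fun m _ => ?_
  rw [laplaceFactor]
  simp only [sojourn, rewardRate]
  cases C m ω using Fin.lastCases with
  | last => simp
  | cast i =>
    simp only [Fin.lastCases_castSucc, Matrix.mulVec, dotProduct, Finset.sum_mul]
    congr 2
    exact Finset.sum_congr rfl fun k _ => by ring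

end Pathwise

/-! ### Finite paths and expectations of functionals of the chain. -/

section Chain

variable {Ω : Type*} [MeasurableSpace Ω] {μ : Measure Ω} {m : ℕ}
  {v : Fin m → ℝ} {Q : Matrix (Fin m) (Fin m) ℝ} {C : ℕ → Ω → Fin m}

/-- The path of the chain up to time `n`. -/
def initialPath (C : ℕ → Ω → Fin m) (n : ℕ) (ω : Ω) : Fin (n + 1) → Fin m := fun k => C k ω

/-- The probability of a finite path. -/
noncomputable def pathWeight (v : Fin m → ℝ) (Q : Matrix (Fin m) (Fin m) ℝ) (n : ℕ)
    (x : Fin (n + 1) → Fin m) : ℝ :=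
  v (x 0) * ∏ k : Fin n, Q (x k.castSucc) (x k.succ)

theorem IsMarkovChain.measurable_initialPath (hC : IsMarkovChain μ v Q C) (n : ℕ) :
    Measurable (initialPath C n) := measurable_pi_lambda _ fun k => hC.1 k

theorem IsMarkovChain.measureReal_initialPath (hC : IsMarkovChain μ v Q C) (n : ℕ)
    (x : Fin (n + 1) → Fin m) :
    μ.real (initialPath C n ⁻¹' {x}) = pathWeight v Q n x := by
  -- The value x 0 beyond time n is a dummy: only indices up to n enter.
  set y : ℕ → Fin m := fun k => if h : k < n + 1 then x ⟨k, h⟩ else x 0 with hy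
  have hyx : ∀ k : Fin (n + 1), y k = x k := fun k => dif_pos k.2
  have h := hC.2 n y
  rw [pathWeight, ← hyx 0, ← show _ = ∏ k : Fin n, Q (x k.castSucc) (x k.succ) from
    (Fin.prod_univ_eq_prod_range (fun k => Q (y k) (y (k + 1))) n).symm.trans
      (Finset.prod_congr rfl fun k _ => by rw [← hyx, ← hyx]; rfl)]
  refine Eq.trans ?_ h
  congr 1
  ext ω
  simp only [Set.mem_preimage, Set.mem_singleton_iff, Set.mem_ofPred_eq, funext_iff, initialPath]
  refine ⟨fun H k hk => ?_, fun H k => ?_⟩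
  · have := H ⟨k, Nat.lt_succ_of_le hk⟩
    rw [← hyx] at this
    exact this
  · rw [← hyx]
    exact H k (Nat.le_of_lt_succ k.2)

theorem IsMarkovChain.measurable_comp (hC : IsMarkovChain μ v Q C) {β : Type*}
    [MeasurableSpace β] {g : Fin m → Ω → β} (hg : ∀ j, Measurable (g j)) (n : ℕ) :
    Measurable fun ω => g (C n ω) ω :=
  (measurable_from_prod_countable_right (f := fun q : Fin m × Ω => g q.1 q.2) hg).comp
    ((hC.1 n).prodMk measurable_id)

theorem IsMarkovChain.integral_eq_sum_indicator (hC : IsMarkovChain μ v Q C) (n : ℕ)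
    {F : (Fin (n + 1) → Fin m) → Ω → ℝ} (hF : ∀ x, Integrable (F x) μ) :
    ∫ ω, F (initialPath C n ω) ω ∂μ
      = ∑ x, ∫ ω, (initialPath C n ⁻¹' {x}).indicator 1 ω * F x ω ∂μ := by
  rw [← integral_finsetSum]
  · refine integral_congr_ae (Filter.Eventually.of_forall fun ω => ?_)
    dsimp only
    rw [Finset.sum_eq_single (initialPath C n ω)]
    · simp
    · intro x _ hx
      rw [Set.indicator_of_notMem (by simpa using hx.symm), zero_mul]
    · simp
  · intro x _
    have hs := hC.measurable_initialPath n (measurableSet_singleton x)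
    have := (hF x).indicator hs
    refine this.congr (Filter.Eventually.of_forall fun ω => ?_)
    by_cases hω : ω ∈ initialPath C n ⁻¹' {x}
    · simp [Set.indicator_of_mem hω]
    · simp [Set.indicator_of_notMem hω]

variable [IsProbabilityMeasure μ]

theorem IsMarkovChain.integral_comp_initialPath (hC : IsMarkovChain μ v Q C) (n : ℕ)
    (f : (Fin (n + 1) → Fin m) → ℝ) :
    ∫ ω, f (initialPath C n ω) ∂μ = ∑ x, pathWeight v Q n x * f x := by
  rw [hC.integral_eq_sum_indicator n (F := fun x _ => f x) fun x => integrable_const _]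
  refine Finset.sum_congr rfl fun x _ => ?_
  rw [integral_mul_const, integral_indicator_one
    (hC.measurable_initialPath n (measurableSet_singleton x)), hC.measureReal_initialPath]

/-- The expectation of a multiplicative functional of the chain. -/
theorem IsMarkovChain.integral_prod_mul (hC : IsMarkovChain μ v Q C) (n : ℕ) (φ : Fin m → ℝ)
    (g : ℕ → Fin m → ℝ) (hg : ∀ n i, g (n + 1) i = φ i * ∑ j, Q i j * g n j) :
    ∫ ω, (∏ k ∈ Finset.range n, φ (C k ω)) * g 0 (C n ω) ∂μ = ∑ i, v i * g n i := by
  have h := hC.integral_comp_initialPath n fun x => (∏ k : Fin n, φ (x k.castSucc)) *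
    g 0 (x (Fin.last n))
  rw [← sum_path_eq_iterate (Matrix.of fun i j => φ i * Q i j) g (fun n i => by
    simp only [hg, Finset.mul_sum, Matrix.of_apply, mul_assoc])]
  refine Eq.trans ?_ (h.trans (Finset.sum_congr rfl fun x _ => ?_))
  · congr 1
    ext ω
    rw [← Fin.prod_univ_eq_prod_range (fun k => φ (C k ω)) n]
    rfl
  · simp only [Matrix.of_apply, Finset.prod_mul_distrib, pathWeight]
    ring

/-- There are countably many finite paths, and those of weight zero are null events; a path of
nonzero weight has a nonzero last transition. -/
theorem IsMarkovChain.ae_transition_ne_zero (hC : IsMarkovChain μ v Q C) :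
    ∀ᵐ ω ∂μ, ∀ n, Q (C n ω) (C (n + 1) ω) ≠ 0 := by
  have h : ∀ᵐ ω ∂μ, ∀ n, ∀ x : Fin (n + 1) → Fin m,
      initialPath C n ω = x → pathWeight v Q n x ≠ 0 := by
    rw [ae_all_iff]; intro n
    rw [ae_all_iff]; intro x
    by_cases hx : pathWeight v Q n x = 0
    · rw [← hC.measureReal_initialPath, measureReal_eq_zero_iff] at hx
      filter_upwards [measure_eq_zero_iff_ae_notMem.1 hx] with ω hω h
      exact absurd h hω
    · exact Filter.Eventually.of_forall fun ω _ => hx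
  filter_upwards [h] with ω hω n
  have := right_ne_zero_of_mul (hω (n + 1) _ rfl)
  exact Finset.prod_ne_zero_iff.1 this (Fin.last n) (Finset.mem_univ _)

end Chain

/-! ### Almost sure absorption and integrating out the holding times. -/

section Absorption

variable {Ω : Type*} [MeasurableSpace Ω] {μ : Measure Ω} [IsProbabilityMeasure μ] {p : ℕ}
  {v : Fin (p + 1) → ℝ} {Q : Matrix (Fin (p + 1)) (Fin (p + 1)) ℝ} {C : ℕ → Ω → Fin (p + 1)}

theorem IsMarkovChain.ae_exists_eq_last (hC : IsMarkovChain μ v Q C)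
    (hQ : IsAbsorbingTransitionMatrix Q) : ∀ᵐ ω ∂μ, ∃ n, C n ω = Fin.last p := by
  have hval : ∀ n, μ.real {ω | C n ω ≠ Fin.last p} = ∑ i, v i * survival Q n i := fun n => by
    rw [← hC.integral_prod_mul n (fun _ => 1) (survival Q) (by simp [survival]),
      ← integral_indicator_one]
    · congr 1
      ext ω
      by_cases h : C n ω = Fin.last p <;> simp [survival, h]
    · exact (hC.1 n) (measurableSet_singleton (Fin.last p)).compl
  have hlim : Filter.Tendsto (fun n => μ.real {ω | C n ω ≠ Fin.last p}) Filter.atTop (nhds 0) := by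
    simp_rw [hval]
    have := tendsto_finsetSum (f := fun i n => v i * survival Q n i) Finset.univ
      fun i _ => (hQ.tendsto_survival i).const_mul (v i)
    simpa using this
  rw [ae_iff, ← measureReal_eq_zero_iff]
  refine le_antisymm (ge_of_tendsto' hlim fun n => measureReal_mono fun ω hω => ?_)
    measureReal_nonneg
  exact fun h => hω ⟨n, h⟩

theorem IsMarkovChain.ae_exists_absorbedAt (hC : IsMarkovChain μ v Q C)
    (hQ : IsAbsorbingTransitionMatrix Q) {Z : Fin p → ℕ → Ω → ℝ}
    (hZ : ∀ᵐ ω ∂μ, ∀ i k, 0 < Z i k ω) : ∀ᵐ ω ∂μ, ∃ N, AbsorbedAt C Z ω N := by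
  classical
  filter_upwards [hC.ae_exists_eq_last hQ, hC.ae_transition_ne_zero, hZ] with ω hex hne hpos
  refine ⟨Nat.find hex, fun k hk => Nat.find_min hex hk, fun k hk => ?_, hpos⟩
  induction k, hk using Nat.le_induction with
  | base => exact Nat.find_spec hex
  | succ k _ ih =>
    by_contra hcon
    exact hne k (by rw [ih]; exact hQ.last_ne hcon)

theorem measurable_laplaceFactor {Z : Fin p → ℕ → Ω → ℝ} (hZ : ∀ i k, Measurable (Z i k))
    (b : Fin p → ℝ) (k : ℕ) (j : Fin (p + 1)) :
    Measurable fun ω => laplaceFactor Z b k ω j := by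
  induction j using Fin.lastCases with
  | last => simp only [laplaceFactor_last]; exact measurable_const
  | cast i =>
    simp only [laplaceFactor_castSucc]
    have := hZ i k
    fun_prop

theorem abs_prod_le_one {ι : Type*} {s : Finset ι} {f : ι → ℝ} (h : ∀ i ∈ s, |f i| ≤ 1) :
    |∏ i ∈ s, f i| ≤ 1 := by
  rw [Finset.abs_prod]
  exact Finset.prod_le_one (fun i _ => abs_nonneg _) h

/-- The Laplace transform of the holding time in a state; `1` for the absorbing state. -/
noncomputable def holdingLaplace (lam d : Fin p → ℝ) : Fin (p + 1) → ℝ :=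
  Fin.lastCases 1 fun i => lam i / (lam i + d i)

theorem integral_prod_laplaceFactor {Z : Fin p → ℕ → Ω → ℝ} {b lam d : Fin p → ℝ}
    (hp : Nonempty (Fin p)) (hZ : ∀ i k, Measurable (Z i k))
    (hL : ∀ i k, ∫ ω, Real.exp (-(b i * Z i k ω)) ∂μ = lam i / (lam i + d i))
    (hZind : iIndepFun (fun (a : Fin p × ℕ) => Z a.1 a.2) μ) {n : ℕ}
    (x : Fin n → Fin (p + 1)) :
    ∫ ω, ∏ k : Fin n, laplaceFactor Z b k ω (x k) ∂μ = ∏ k : Fin n, holdingLaplace lam d (x k) := by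
  obtain ⟨i₀⟩ := hp
  -- The absorbing state has no holding variable, so it borrows the index i₀ with a constant
  -- function `g`. Distinct times k keep the selected variables distinct, hence independent.
  set idx : Fin (p + 1) → Fin p := Fin.lastCases i₀ id with hidx
  set g : Fin (p + 1) → ℝ → ℝ := Fin.lastCases (fun _ => 1) fun i z => Real.exp (-(b i * z)) with hg
  have hgm : ∀ j, Measurable (g j) := fun j => by
    induction j using Fin.lastCases with
    | last => simp only [hg, Fin.lastCases_last]; exact measurable_const
    | cast i => simp only [hg, Fin.lastCases_castSucc]; fun_prop
  have hfac : ∀ (k : ℕ) ω j, laplaceFactor Z b k ω j = g j (Z (idx j) k ω) := fun k ω j => by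
    induction j using Fin.lastCases with
    | last => simp [laplaceFactor_last, hg]
    | cast i => simp [laplaceFactor_castSucc, hg, hidx]
  have hinj : Function.Injective fun k : Fin n => (idx (x k), (k : ℕ)) := fun k l h =>
    Fin.ext (Prod.ext_iff.1 h).2
  have hind := (hZind.precomp hinj).comp (fun k => g (x k)) fun k => hgm _
  have hind' : iIndepFun (fun (k : Fin n) ω => laplaceFactor Z b k ω (x k)) μ := by
    refine hind.congr fun k => Filter.Eventually.of_forall fun ω => ?_
    simp [hfac]
  rw [hind'.integral_fun_prod_eq_prod_integral fun k =>
    (measurable_laplaceFactor hZ b k (x k)).aestronglyMeasurable]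
  refine Finset.prod_congr rfl fun k _ => ?_
  cases x k using Fin.lastCases with
  | last => simp [laplaceFactor_last, holdingLaplace]
  | cast i => simp [laplaceFactor_castSucc, holdingLaplace, hL]

/-- Conditioning on the chain as a finite sum: on each path the indicator is independent of the
holding variables, whose product integrates to the product of transforms. -/
theorem IsMarkovChain.integral_prod_laplaceFactor (hC : IsMarkovChain μ v Q C)
    {Z : Fin p → ℕ → Ω → ℝ} {b lam d : Fin p → ℝ}
    (hp : Nonempty (Fin p)) (hZ : ∀ i k, Measurable (Z i k))
    (hpos : ∀ᵐ ω ∂μ, ∀ i k, 0 < Z i k ω) (hb : ∀ i, 0 ≤ b i)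
    (hL : ∀ i k, ∫ ω, Real.exp (-(b i * Z i k ω)) ∂μ = lam i / (lam i + d i))
    (hZind : iIndepFun (fun (a : Fin p × ℕ) => Z a.1 a.2) μ)
    (hCZ : IndepFun (fun ω (m : ℕ) => C m ω) (fun ω (a : Fin p × ℕ) => Z a.1 a.2 ω) μ) (n : ℕ) :
    ∫ ω, ∏ k ∈ Finset.range n, laplaceFactor Z b k ω (C k ω) ∂μ
      = ∫ ω, ∏ k ∈ Finset.range n, holdingLaplace lam d (C k ω) ∂μ := by
  have hmeas : ∀ x : Fin (n + 1) → Fin (p + 1),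
      Measurable fun ω => ∏ k : Fin n, laplaceFactor Z b k ω (x k.castSucc) := fun x =>
    Finset.measurable_fun_prod _ fun k _ => measurable_laplaceFactor hZ b k _
  have h1 := hC.integral_eq_sum_indicator n
    (F := fun x ω => ∏ k : Fin n, laplaceFactor Z b k ω (x k.castSucc)) fun x => by
      refine Integrable.of_bound (hmeas x).aestronglyMeasurable 1 ?_
      filter_upwards [hpos] with ω hω
      exact abs_prod_le_one fun k _ => abs_laplaceFactor_le_one hω hb _ _
  have h2 := hC.integral_comp_initialPath n fun x =>
    ∏ k : Fin n, holdingLaplace lam d (x k.castSucc)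
  simp_rw [← Fin.prod_univ_eq_prod_range (fun k => laplaceFactor Z b k _ (C k _)) n,
    ← Fin.prod_univ_eq_prod_range (fun k => holdingLaplace lam d (C k _)) n]
  refine h1.trans (Eq.trans (Finset.sum_congr rfl fun x _ => ?_) h2.symm)
  have hs := hC.measurable_initialPath n (measurableSet_singleton x)
  have hset : MeasurableSet {c : ℕ → Fin (p + 1) | (fun k : Fin (n + 1) => c k) = x} :=
    (measurable_pi_lambda (fun (c : ℕ → Fin (p + 1)) (k : Fin (n + 1)) => c k)
      fun k => measurable_pi_apply _) (measurableSet_singleton x)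
  have hind := hCZ.comp
    (φ := Set.indicator {c : ℕ → Fin (p + 1) | (fun k : Fin (n + 1) => c k) = x} (1 : (ℕ → Fin (p + 1)) → ℝ))
    (ψ := fun z : Fin p × ℕ → ℝ =>
      ∏ k : Fin n, laplaceFactor (fun i k (z : Fin p × ℕ → ℝ) => z (i, k)) b k z (x k.castSucc))
    (measurable_one.indicator hset)
    (Finset.measurable_fun_prod _ fun k _ =>
      measurable_laplaceFactor (fun i k => measurable_pi_apply _) b k _)
  have hmul := IndepFun.integral_fun_mul_eq_mul_integral
    (X := (initialPath C n ⁻¹' {x}).indicator (1 : Ω → ℝ)) hind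
    (measurable_one.indicator hs).aestronglyMeasurable (hmeas x).aestronglyMeasurable
  refine hmul.trans ?_
  rw [integral_indicator_one hs, hC.measureReal_initialPath]
  congr 1
  exact FracPH.integral_prod_laplaceFactor hp hZ hL hZind fun k => x k.castSucc

end Absorption

end FracPH

/-! ### The Laplace transform of the reward vector. -/

theorem mainTheorem4 {Ω : Type*} [MeasurableSpace Ω] (μ : Measure Ω) [IsProbabilityMeasure μ]
    (p n : ℕ) (α : ℝ) (hα0 : 0 < α) (hα1 : α ≤ 1)
    (lam : Fin p → ℝ) (hlam : ∀ i, 0 < lam i)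
    (Q : Matrix (Fin (p + 1)) (Fin (p + 1)) ℝ) (hQ : IsAbsorbingTransitionMatrix Q)
    (w : Fin p → ℝ) (hw : ∀ i, 0 ≤ w i) (hw1 : ∑ i, w i = 1)
    (C : ℕ → Ω → Fin (p + 1)) (hC : IsMarkovChain μ (initialLaw w) Q C)
    (Z : Fin p → ℕ → Ω → ℝ) (hZ : ∀ i m, IsMittagLeffler μ (Z i m) α (lam i))
    (hZind : iIndepFun (fun (a : Fin p × ℕ) => Z a.1 a.2) μ)
    (hCZ : IndepFun (fun ω (m : ℕ) => C m ω) (fun ω (a : Fin p × ℕ) => Z a.1 a.2 ω) μ)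
    (R : Matrix (Fin p) (Fin n) ℝ) (hR : ∀ i k, 0 ≤ R i k) :
    (∀ᵐ ω ∂μ, absorptionTime C Z ω < ∞) ∧
    (∀ k, AEMeasurable (totalReward C Z R k) μ) ∧
    ∀ θ : Fin n → ℝ, (∀ k, 0 ≤ θ k) →
      IsUnit (Matrix.diagonal (fun i => (R.mulVec θ i) ^ α) - subIntensity lam Q) ∧
      ∫ ω, Real.exp (-∑ k, totalReward C Z R k ω * θ k) ∂μ =
        w ⬝ᵥ ((Matrix.diagonal (fun i => (R.mulVec θ i) ^ α) - subIntensity lam Q)⁻¹.mulVec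
          (exitRates lam Q)) := by
  have hZm : ∀ i k, Measurable (Z i k) := fun i k => (hZ i k).1
  have hpos : ∀ᵐ ω ∂μ, ∀ i k, 0 < Z i k ω := by
    simp_rw [ae_all_iff]
    exact fun i k => (hZ i k).ae_pos
  have habs := hC.ae_exists_absorbedAt hQ hpos
  refine ⟨?_, fun k => ?_, fun θ hθ => ?_⟩
  · filter_upwards [habs] with ω ⟨N, hN⟩
    rw [hN.absorptionTime_eq]
    exact ENNReal.ofReal_lt_top
  -- The reward is almost surely the limit of eventually constant, measurable truncated sums.
  · refine aemeasurable_of_tendsto_metrizable_ae Filter.atTop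
      (f := fun M ω => ∑ m ∈ Finset.range M, rewardRate R k (C m ω) * sojourn C Z m ω)
      (fun M => ?_) ?_
    · refine (Finset.measurable_fun_sum _ fun m _ => ?_).aemeasurable
      refine hC.measurable_comp (g := fun j ω => rewardRate R k j *
        Fin.lastCases (motive := fun _ => ℝ) 0 (fun i => Z i m ω) j) (fun j => ?_) m
      refine measurable_const.mul ?_
      induction j using Fin.lastCases with
      | last => simp only [Fin.lastCases_last]; exact measurable_const
      | cast i => simp only [Fin.lastCases_castSucc]; exact hZm i m
    · filter_upwards [habs] with ω ⟨N, hN⟩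
      exact tendsto_atTop_of_eventually_const fun M hM => (hN.totalReward_eq_of_le R k hM).symm
  · have hb : ∀ i, 0 ≤ R.mulVec θ i := fun i => by
      simp only [Matrix.mulVec, dotProduct]
      exact Finset.sum_nonneg fun k _ => mul_nonneg (hR i k) (hθ k)
    set d : Fin p → ℝ := fun i => (R.mulVec θ i) ^ α with hd
    have hd0 : ∀ i, 0 ≤ d i := fun i => Real.rpow_nonneg (hb i) α
    refine ⟨isUnit_diagonal_sub_subIntensity hQ hlam hd0, ?_⟩
    have hp : Nonempty (Fin p) := by
      by_contra hne
      rw [not_nonempty_iff] at hne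
      simp at hw1
    have hL : ∀ i k, ∫ ω, Real.exp (-(R.mulVec θ i * Z i k ω)) ∂μ = lam i / (lam i + d i) :=
      fun i k => (hZ i k).integral_exp_neg hα0 (hlam i) (hb i)
    set h := absorptionValue lam d Q with hh
    set φ := holdingLaplace lam d with hφ
    have hφ1 : ∀ j, |φ j| ≤ 1 := fun j => by
      induction j using Fin.lastCases with
      | last => simp [hφ, holdingLaplace]
      | cast i =>
        have := hlam i
        have := hd0 i
        simp only [hφ, holdingLaplace, Fin.lastCases_castSucc]
        rw [abs_of_nonneg (by positivity), div_le_one (by positivity)]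
        linarith
    have hφm : ∀ M, Measurable fun ω => ∏ k ∈ Finset.range M, φ (C k ω) := fun M =>
      Finset.measurable_fun_prod _ fun k _ => (measurable_of_countable φ).comp (hC.1 k)
    have hlim : Filter.Tendsto
        (fun M => ∫ ω, ∏ k ∈ Finset.range M, laplaceFactor Z (R.mulVec θ) k ω (C k ω) ∂μ)
        Filter.atTop (nhds (∫ ω, Real.exp (-∑ k, totalReward C Z R k ω * θ k) ∂μ)) := by
      refine tendsto_integral_of_dominated_convergence (fun _ => 1) (fun M => ?_)
        (integrable_const _) (fun M => ?_) ?_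
      · exact (Finset.measurable_fun_prod _ fun k _ => hC.measurable_comp
          (measurable_laplaceFactor hZm _ k) k).aestronglyMeasurable
      · filter_upwards [hpos] with ω hω
        exact abs_prod_le_one fun k _ => abs_laplaceFactor_le_one hω hb _ _
      · filter_upwards [habs] with ω ⟨N, hN⟩
        exact tendsto_atTop_of_eventually_const fun M hM => (hN.exp_neg_totalReward R θ hM).symm
    -- After absorption h(C_M) = 1, so the integrand vanishes eventually; finiteness of the state
    -- space supplies the dominating constant, without any bound on h.
    have hdiff : Filter.Tendsto
        (fun M => ∫ ω, (∏ k ∈ Finset.range M, φ (C k ω)) * (1 - h (C M ω)) ∂μ)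
        Filter.atTop (nhds (∫ _, (0 : ℝ) ∂μ)) := by
      refine tendsto_integral_of_dominated_convergence (fun _ => ∑ j, |1 - h j|) (fun M => ?_)
        (integrable_const _) (fun M => Filter.Eventually.of_forall fun ω => ?_) ?_
      · exact ((hφm M).mul ((measurable_of_countable fun j => 1 - h j).comp
          (hC.1 M))).aestronglyMeasurable
      · rw [norm_mul, Real.norm_eq_abs, Real.norm_eq_abs]
        refine (mul_le_of_le_one_left (abs_nonneg _) (abs_prod_le_one fun k _ => hφ1 _)).trans ?_
        exact Finset.single_le_sum (f := fun j => |1 - h j|) (fun j _ => abs_nonneg _)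
          (Finset.mem_univ (C M ω))
      · filter_upwards [habs] with ω ⟨N, hN⟩
        refine tendsto_atTop_of_eventually_const (i₀ := N) fun M hM => ?_
        rw [hN.after M hM]
        simp [hh, absorptionValue]
    -- As h is fixed by the one-step operator, the iterates are the constant sequence h.
    have hconst : ∀ M, ∫ ω, (∏ k ∈ Finset.range M, φ (C k ω)) * h (C M ω) ∂μ
        = ∑ i, initialLaw w i * h i := fun M =>
      hC.integral_prod_mul M φ (fun _ => h) fun _ i => (absorptionValue_eq hQ hlam hd0 i).symm
    have hsub : ∀ M, ∫ ω, ∏ k ∈ Finset.range M, laplaceFactor Z (R.mulVec θ) k ω (C k ω) ∂μ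
        = (∫ ω, (∏ k ∈ Finset.range M, φ (C k ω)) * (1 - h (C M ω)) ∂μ)
          + ∑ i, initialLaw w i * h i := fun M => by
      have hint : ∀ f : Fin (p + 1) → ℝ,
          Integrable (fun ω => (∏ k ∈ Finset.range M, φ (C k ω)) * f (C M ω)) μ := fun f => by
        refine Integrable.of_bound ((hφm M).mul ((measurable_of_countable f).comp
          (hC.1 M))).aestronglyMeasurable (∑ j, |f j|) (Filter.Eventually.of_forall fun ω => ?_)
        rw [norm_mul, Real.norm_eq_abs, Real.norm_eq_abs]
        refine (mul_le_of_le_one_left (abs_nonneg _) (abs_prod_le_one fun k _ => hφ1 _)).trans ?_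
        exact Finset.single_le_sum (f := fun j => |f j|) (fun j _ => abs_nonneg _)
          (Finset.mem_univ (C M ω))
      rw [← hconst M, ← integral_add (hint fun j => 1 - h j) (hint h),
        hC.integral_prod_laplaceFactor hp hZm hpos hb hL hZind hCZ]
      congr 1
      ext ω
      ring
    simp_rw [hsub] at hlim
    have huniq := tendsto_nhds_unique hlim (hdiff.add_const _)
    rw [huniq, integral_zero, zero_add, Fin.sum_univ_castSucc]
    simp [initialLaw, hh, absorptionValue, dotProduct]
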